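/- Let $d\in\{2,3\}$, let $\Omega\subset\mathbb R^d$ be a bounded domain (nonempty, open, connected), and let $\epsilon>0$. Let $J:\mathbb R\to[0,\infty)$ be a bounded measurable function that vanishes outside $[0,1]$ and is positive on $(0,\delta)$ for some $\delta>0$; let $\omega_d$ be the volume of the unit ball of $\mathbb R^d$ and $H_\epsilon(x)$ the ball of radius $\epsilon$ centered at $x$. Let $r^e<0<r^c$ and let $g:\mathbb R\to\mathbb R$ be three times differentiable with $g,g',g'',g'''$ bounded, $g(0)=0$, $g(r)>0$ for $r\neq 0$, $g$ convex on $[r^e,r^c]$ with $g''>0$ on $(r^e,r^c)$, $g$ concave on $(-\infty,r^e]$ and on $[r^c,\infty)$, with finite limits at $\pm\infty$, and $|g''(r)|\le g''(0)$ for all $r$. For a field $u$ on $\Omega$ with values in $\mathbb R^d$ put $e_{y-x}=\frac{y-x}{|y-x|}$, $S(y,x,u)=\frac{u(y)-u(x)}{|y-x|}\cdot e_{y-x}$. Let $\mathcal V$ be the space of all $u\in L^\infty(\Omega;\mathbb R^d)$ with $\int_\Omega u\cdot w\,dx=0$ for every $w(x)=Qx+c$ with $Q^T=-Q\in\mathbb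 R^{d\times d}$, $c\in\mathbb R^d$, with the $L^\infty$ norm. A field $u\in\mathcal V$ is in the strength domain if $\sqrt{|y-x|}\,S(y,x,u)\in(r^e,r^c)$ for a.e. $x\in\Omega$ and a.e. $y\in\Omega\cap H_\epsilon(x)$, and strictly inside it if these values lie in a fixed closed interval $[a,b]\subset(r^e,r^c)$. For $b_0\in\mathcal V$ let $$E[u]=\int_\Omega\int_{H_\epsilon(x)\cap\Omega}|y-x|\,\frac{J(|y-x|/\epsilon)}{\epsilon^{d+1}\omega_d|y-x|}\,g\big(\sqrt{|y-x|}\,S(y,x,u)\big)\,dy\,dx-\int_\Omega u\cdot b_0\,dx ,$$ $$\mathcal L[u](x)=-\int_{H_\epsilon(x)\cap\Omega}\frac{2J(|y-x|/\epsilon)}{\epsilon^{d+1}\omega_d\sqrt{|y-x|}}\,g'\big(\sqrt{|y-x|}\,S(y,x,u)\big)\,e_{y-x}\,dy .$$ A critical point of $E$ is a $u\in\mathcal V$ at which the Fréchet derivative $DE[u]$ of $E:\mathcal V\to\mathbb R$ exists and is zero. Assume that $u_0\in\mathcal V$ lies strictly inside the strength domain and is a critical point of $E$. Then a field $u\in\mathcal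 V$ is a critical point of $E$ if and only if $\mathcal L[u]=b_0$ a.e. in $\Omega$, and there is $R>0$ such that, among all $u\in\mathcal V$ in the strength domain with $\|u-u_0\|_\infty\le R$, the field $u_0$ is the unique critical point of $E$ and the unique minimizer of $E$; in particular $E[u]\ge E[u_0]$ for all such $u$. -/

import Mathlib

open MeasureTheory Set Filter Topology
open scoped ENNReal

noncomputable section

namespace Peridynamics

/-- The Euclidean space `ℝ^d`. -/
abbrev Vec (d : ℕ) : Type := EuclideanSpace ℝ (Fin d)

variable {d : ℕ}

/-- Assumptions on the influence function `J`: nonnegative, bounded, supported in `[0,1]`, and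
nondegenerate, in that it does not vanish at small positive distances. -/
structure IsInfluenceFunction (J : ℝ → ℝ) : Prop where
  measurable : Measurable J
  nonneg : ∀ r, 0 ≤ J r
  bounded : ∃ M, ∀ r, J r ≤ M
  support : ∀ r, r ∉ Icc (0 : ℝ) 1 → J r = 0
  pos : ∃ δ > 0, ∀ r ∈ Ioo (0 : ℝ) δ, 0 < J r

/-- Assumptions on the cohesive potential `g`, with `(re, rc)` its interval of convexity. -/
structure IsCohesivePotential (g : ℝ → ℝ) (re rc : ℝ) : Prop where
  re_neg : re < 0
  rc_pos : 0 < rc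
  differentiable : ∀ k < 3, Differentiable ℝ (iteratedDeriv k g)
  bounded : ∀ k ≤ 3, ∃ M, ∀ r, |iteratedDeriv k g r| ≤ M
  zero : g 0 = 0
  pos : ∀ r, r ≠ 0 → 0 < g r
  convex : ConvexOn ℝ (Icc re rc) g
  concave_left : ConcaveOn ℝ (Iic re) g
  concave_right : ConcaveOn ℝ (Ici rc) g
  second_deriv_pos : ∀ r ∈ Ioo re rc, 0 < iteratedDeriv 2 g r
  second_deriv_max : ∀ r, |iteratedDeriv 2 g r| ≤ iteratedDeriv 2 g 0
  tendsto_atBot : ∃ C, Tendsto g atBot (𝓝 C)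
  tendsto_atTop : ∃ C, Tendsto g atTop (𝓝 C)

/-- The unit vector `e_{y-x}`. -/
def unitVec (y x : Vec d) : Vec d := ‖y - x‖⁻¹ • (y - x)

/-- The nonlocal strain `S(y,x,u)`. -/
def strain (y x : Vec d) (u : Vec d → Vec d) : ℝ :=
  inner ℝ (‖y - x‖⁻¹ • (u y - u x)) (unitVec y x)

/-- The scaled strain `√|y-x| S(y,x,u)`. -/
def scaledStrain (y x : Vec d) (u : Vec d → Vec d) : ℝ :=
  √‖y - x‖ * strain y x u

/-- The volume of the unit ball of `ℝ^d`. -/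
def unitBallVolume (d : ℕ) : ℝ := (volume (Metric.ball (0 : Vec d) 1)).toReal

/-- The pairwise potential `𝒲(S(y,x,u))`. -/
def pairPotential (ε : ℝ) (J g : ℝ → ℝ) (y x : Vec d) (u : Vec d → Vec d) : ℝ :=
  J (‖y - x‖ / ε) / (ε ^ (d + 1) * unitBallVolume d * ‖y - x‖) * g (scaledStrain y x u)

/-- The peridynamic potential energy `PD[u]`. -/
def potentialEnergy (Ω : Set (Vec d)) (ε : ℝ) (J g : ℝ → ℝ) (u : Vec d → Vec d) : ℝ :=
  ∫ x in Ω, ∫ y in Metric.ball x ε ∩ Ω, ‖y - x‖ * pairPotential ε J g y x u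

/-- The total energy `E[u] = PD[u] - ∫ u · b`. -/
def totalEnergy (Ω : Set (Vec d)) (ε : ℝ) (J g : ℝ → ℝ) (b u : Vec d → Vec d) : ℝ :=
  potentialEnergy Ω ε J g u - ∫ x in Ω, inner ℝ (u x) (b x)

/-- The peridynamic force operator `ℒ[u]`. -/
def forceOp (Ω : Set (Vec d)) (ε : ℝ) (J g : ℝ → ℝ) (u : Vec d → Vec d) (x : Vec d) : Vec d :=
  -∫ y in Metric.ball x ε ∩ Ω,
    (2 * (J (‖y - x‖ / ε) / (ε ^ (d + 1) * unitBallVolume d * √‖y - x‖))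
      * deriv g (scaledStrain y x u)) • unitVec y x

/-- `u` belongs to the strength domain: the scaled strain of almost every interacting pair
lies in `(re, rc)`. -/
def InStrengthDomain (Ω : Set (Vec d)) (ε re rc : ℝ) (u : Vec d → Vec d) : Prop :=
  ∀ᵐ x ∂(volume.restrict Ω), ∀ᵐ y ∂(volume.restrict (Metric.ball x ε ∩ Ω)),
    scaledStrain y x u ∈ Ioo re rc

/-- `u` lies strictly inside the strength domain: the scaled strains lie in a fixed closed
interval contained in `(re, rc)`. -/
def StrictlyInStrengthDomain (Ω : Set (Vec d)) (ε re rc : ℝ) (u : Vec d → Vec d) : Prop :=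
  ∃ a b : ℝ, re < a ∧ a ≤ b ∧ b < rc ∧
    ∀ᵐ x ∂(volume.restrict Ω), ∀ᵐ y ∂(volume.restrict (Metric.ball x ε ∩ Ω)),
      scaledStrain y x u ∈ Icc a b

/-- The infinitesimal rigid motions `x ↦ Q x + c` with `Q` skew-symmetric. -/
def rigidMotions (d : ℕ) : Set (Vec d → Vec d) :=
  {w | ∃ (Q : Matrix (Fin d) (Fin d) ℝ) (c : Vec d), Q.transpose = -Q ∧
    w = fun x => Matrix.toEuclideanLin Q x + c}

/-- `L^∞(Ω; ℝ^d)`. -/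
abbrev LInfty (Ω : Set (Vec d)) : Type := Lp (Vec d) ∞ (volume.restrict Ω)

/-- The space `𝒱` of fields in `L^∞(Ω; ℝ^d)` orthogonal to the rigid motions. For bounded `Ω`
the integrability clause holds automatically. -/
def dispSpace (Ω : Set (Vec d)) : Submodule ℝ (LInfty Ω) where
  carrier := {u | ∀ w ∈ rigidMotions d,
    Integrable (fun x => inner ℝ (u x) (w x)) (volume.restrict Ω) ∧
      ∫ x in Ω, inner ℝ (u x) (w x) = 0}
  zero_mem' := by
    intro w _
    have h : (fun x => inner ℝ ((0 : LInfty Ω) x) (w x)) =ᵐ[volume.restrict Ω]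
        fun _ => (0 : ℝ) := by
      filter_upwards [Lp.coeFn_zero (Vec d) ∞ (volume.restrict Ω)] with x hx
      rw [hx]
      simp
    exact ⟨(integrable_congr h).2 (integrable_zero _ _ _), by rw [integral_congr_ae h]; simp⟩
  add_mem' := by
    intro u v hu hv w hw
    have h : (fun x => inner ℝ ((u + v : LInfty Ω) x) (w x)) =ᵐ[volume.restrict Ω]
        fun x => inner ℝ (u x) (w x) + inner ℝ (v x) (w x) := by
      filter_upwards [Lp.coeFn_add u v] with x hx
      rw [hx, Pi.add_apply, inner_add_left]
    refine ⟨(integrable_congr h).2 ((hu w hw).1.add (hv w hw).1), ?_⟩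
    rw [integral_congr_ae h, integral_add (hu w hw).1 (hv w hw).1, (hu w hw).2, (hv w hw).2,
      add_zero]
  smul_mem' := by
    intro c u hu w hw
    have h : (fun x => inner ℝ ((c • u : LInfty Ω) x) (w x)) =ᵐ[volume.restrict Ω]
        fun x => c * inner ℝ (u x) (w x) := by
      filter_upwards [Lp.coeFn_smul c u] with x hx
      rw [hx, Pi.smul_apply, real_inner_smul_left]
    refine ⟨(integrable_congr h).2 ((hu w hw).1.const_mul c), ?_⟩
    rw [integral_congr_ae h, integral_const_mul, (hu w hw).2, mul_zero]

/-- The total energy with load `b` as a functional on `𝒱`. -/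
def energy {Ω : Set (Vec d)} (ε : ℝ) (J g : ℝ → ℝ) (b u : dispSpace Ω) : ℝ :=
  totalEnergy Ω ε J g (b : LInfty Ω) (u : LInfty Ω)

/-- `u` is a critical point of the energy with load `b`: the Fréchet derivative of the energy on
`𝒱` (with the `L^∞` norm) exists and vanishes at `u`. -/
def IsCriticalPoint {Ω : Set (Vec d)} (ε : ℝ) (J g : ℝ → ℝ) (b u : dispSpace Ω) : Prop :=
  HasFDerivAt (fun v : dispSpace Ω => energy ε J g b v) (0 : dispSpace Ω →L[ℝ] ℝ) u

end Peridynamics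

end

open MeasureTheory Set Filter Topology
open scoped ENNReal

noncomputable section

namespace Peridynamics

variable {d : ℕ}

/-! ### Taylor bounds and strict convexity of the cohesive potential. -/

section Potential

variable {g : ℝ → ℝ} {re rc : ℝ}

/-! The potential energy is the double integral over Ω × Ω of a bounded bond weight times `g` of the
scaled strain, and the strain is linear in the field. Expanding `g` to first order at the strain of
`u` leaves a remainder of at most g''(0) times the squared strain of the increment w, hence of order
‖w‖∞² / |y - x|. Since d ≥ 2, the singularity 1/|y - x| is integrable
(`integrable_inv_norm_sub_prod`), so the energy is Fréchet differentiable at every field of 𝒱.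
Antisymmetry of the bond force under x ↔ y identifies the derivative as the L² pairing with ℒ[u] - b
(`integral_first_variation`, `hasFDerivAt_energy`). This residual lies in 𝒱 because rigid motions
have zero strain; testing the derivative with it gives the Euler–Lagrange equation
(`isCriticalPoint_iff`).

At a critical point `u` the energy difference E[v] - E[u] is exactly the integrated remainder. If
both fields are in the strength domain, all strains lie where `g` is strictly convex, so the
remainder is nonnegative. If it integrates to zero, `u` and `v` have equal strains on short bonds.
Then v - u is locally affine and rigid, by connectedness a single rigid motion, and by orthogonality
zero (`exists_rigidMotion_of_isConnected`, `dispSpace_eq_of_scaledStrain_eq`). -/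

theorem IsCohesivePotential.differentiable_self (hg : IsCohesivePotential g re rc) :
    Differentiable ℝ g := by
  simpa using hg.differentiable 0 (by norm_num)

theorem IsCohesivePotential.differentiable_deriv (hg : IsCohesivePotential g re rc) :
    Differentiable ℝ (deriv g) := by
  simpa using hg.differentiable 1 (by norm_num)

theorem IsCohesivePotential.bounded_self (hg : IsCohesivePotential g re rc) :
    ∃ M, ∀ r, |g r| ≤ M := by
  simpa using hg.bounded 0 (by norm_num)

theorem IsCohesivePotential.bounded_deriv (hg : IsCohesivePotential g re rc) :
    ∃ M, ∀ r, |deriv g r| ≤ M := by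
  simpa using hg.bounded 1 (by norm_num)

theorem deriv_deriv_eq_iteratedDeriv (g : ℝ → ℝ) :
    deriv (deriv g) = iteratedDeriv 2 g := by
  rw [iteratedDeriv_succ, iteratedDeriv_one]

/-- The remainder of the first order Taylor expansion of `g` is quadratic. -/
theorem IsCohesivePotential.abs_taylor_le (hg : IsCohesivePotential g re rc) (a b : ℝ) :
    |g b - g a - deriv g a * (b - a)| ≤ iteratedDeriv 2 g 0 * (b - a) ^ 2 := by
  have hM := hg.second_deriv_max
  have hlip : ∀ t, |deriv g t - deriv g a| ≤ iteratedDeriv 2 g 0 * |t - a| := fun t =>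
    Convex.norm_image_sub_le_of_norm_deriv_le (f := deriv g) (s := univ)
      (fun x _ => hg.differentiable_deriv x)
      (fun x _ => by rw [deriv_deriv_eq_iteratedDeriv]; exact hM x) convex_univ
      (mem_univ _) (mem_univ _)
  have hM0 : 0 ≤ iteratedDeriv 2 g 0 := (abs_nonneg _).trans (hM 0)
  -- The mean value inequality for g minus its tangent slope gives the quadratic bound without
  -- Taylor's factor 1/2, which is not needed.
  have key := Convex.norm_image_sub_le_of_norm_hasDerivWithin_le
    (f := fun t => g t - deriv g a * t) (f' := fun t => deriv g t - deriv g a) (s := uIcc a b)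
    (C := iteratedDeriv 2 g 0 * |b - a|) (x := a) (y := b)
    (fun t _ => by
      have h1 := (hg.differentiable_self t).hasDerivAt
      have h2 := (hasDerivAt_id t).const_mul (deriv g a)
      simpa using (h1.fun_sub h2).hasDerivWithinAt)
    (fun t ht => (hlip t).trans (mul_le_mul_of_nonneg_left (abs_sub_left_of_mem_uIcc ht) hM0))
    (convex_uIcc a b) left_mem_uIcc right_mem_uIcc
  rw [Real.norm_eq_abs, Real.norm_eq_abs] at key
  calc _ = |g b - deriv g a * b - (g a - deriv g a * a)| := by congr 1; ring
    _ ≤ iteratedDeriv 2 g 0 * |b - a| * |b - a| := key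
    _ = _ := by rw [mul_assoc, abs_mul_abs_self, sq]

/-- On the interval of convexity the graph of `g` lies strictly above its tangents. -/
theorem IsCohesivePotential.tangent_lt (hg : IsCohesivePotential g re rc) {a b : ℝ}
    (ha : a ∈ Ioo re rc) (hb : b ∈ Ioo re rc) (hab : a ≠ b) :
    0 < g b - g a - deriv g a * (b - a) := by
  have hconv : StrictConvexOn ℝ (Ioo re rc) g :=
    strictConvexOn_of_deriv2_pos' (convex_Ioo _ _) hg.differentiable_self.continuous.continuousOn
      (fun x hx => by
        rw [← iteratedDeriv_eq_iterate]
        exact hg.second_deriv_pos x hx)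
  rcases lt_or_gt_of_ne hab with h | h
  · have := hconv.deriv_lt_slope ha hb h (hg.differentiable_self a)
    rw [slope_def_field, lt_div_iff₀ (sub_pos.2 h)] at this
    linarith
  · have := hconv.slope_lt_deriv hb ha h (hg.differentiable_self a)
    rw [slope_def_field, div_lt_iff₀ (sub_pos.2 h)] at this
    linarith

theorem IsCohesivePotential.tangent_le (hg : IsCohesivePotential g re rc) {a b : ℝ}
    (ha : a ∈ Ioo re rc) (hb : b ∈ Ioo re rc) :
    0 ≤ g b - g a - deriv g a * (b - a) := by
  rcases eq_or_ne a b with rfl | h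
  · simp
  · exact (hg.tangent_lt ha hb h).le

end Potential

/-! ### Bond weights, bond forces and the integrable singularity. -/

section Kernel

/-- In dimension at least two the Newtonian singularity `‖y - x‖⁻¹` is integrable over bounded
sets, uniformly in `x`. -/
theorem exists_integral_inv_norm_sub_le (hd : 2 ≤ d) {Ω : Set (Vec d)}
    (hΩm : MeasurableSet Ω) (hΩ : Bornology.IsBounded Ω) :
    ∃ C : ℝ, ∀ x ∈ Ω, IntegrableOn (fun y => ‖y - x‖⁻¹) Ω ∧ ∫ y in Ω, ‖y - x‖⁻¹ ≤ C := by
  have : Nonempty (Fin d) := ⟨⟨0, by omega⟩⟩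
  obtain ⟨D, hD⟩ := hΩ.subset_ball (0 : Vec d)
  -- In polar coordinates the integrand becomes r^(d-1) · r⁻¹ = r^(d-2), which is where d ≥ 2
  -- enters. The radius 2D covers all differences of points of Ω.
  have hint : IntegrableOn (fun z : Vec d => ‖z‖⁻¹) (Metric.ball 0 (2 * D)) := by
    rw [integrableOn_fun_norm_addHaar volume (f := fun r : ℝ => r⁻¹)]
    have hc : IntegrableOn (fun y : ℝ => y ^ (d - 2)) (Ioo 0 (2 * D)) :=
      ((continuous_pow (d - 2)).integrableOn_Icc (a := (0 : ℝ)) (b := 2 * D)).mono_set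
        Ioo_subset_Icc_self
    refine hc.congr_fun (fun y hy => ?_) measurableSet_Ioo
    have : d - 1 = (d - 2) + 1 := by omega
    simp only [finrank_euclideanSpace, Fintype.card_fin, smul_eq_mul]
    rw [this, pow_succ, mul_assoc, mul_inv_cancel₀ hy.1.ne', mul_one]
  set φ : Vec d → ℝ := (Metric.ball (0 : Vec d) (2 * D)).indicator fun z => ‖z‖⁻¹ with hφ
  have hφi : Integrable φ := (integrable_indicator_iff measurableSet_ball).2 hint
  have hφ0 : ∀ z, 0 ≤ φ z := fun z => indicator_nonneg (fun _ _ => by positivity) z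
  refine ⟨∫ z, φ z, fun x hx => ?_⟩
  have heq : EqOn (fun y => φ (y - x)) (fun y => ‖y - x‖⁻¹) Ω := by
    intro y hy
    have h1 := hD hx
    have h2 := hD hy
    rw [mem_ball_zero_iff] at h1 h2
    have : y - x ∈ Metric.ball (0 : Vec d) (2 * D) := by
      rw [mem_ball_zero_iff]
      linarith [norm_sub_le y x]
    simp only [hφ, indicator_of_mem this]
  have hsub : Integrable fun y => φ (y - x) := hφi.comp_sub_right x
  refine ⟨hsub.integrableOn.congr_fun heq hΩm, ?_⟩
  rw [← setIntegral_congr_fun hΩm heq]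
  calc ∫ y in Ω, φ (y - x) ≤ ∫ y, φ (y - x) :=
        setIntegral_le_integral hsub (Eventually.of_forall fun y => hφ0 _)
    _ = ∫ z, φ z := integral_sub_right_eq_self φ x

theorem isFiniteMeasure_restrict_of_isBounded {Ω : Set (Vec d)} (hΩ : Bornology.IsBounded Ω) :
    IsFiniteMeasure (volume.restrict Ω) :=
  ⟨by simpa using hΩ.measure_lt_top⟩

theorem integrable_inv_norm_sub_prod (hd : 2 ≤ d) {Ω : Set (Vec d)}
    (hΩm : MeasurableSet Ω) (hΩ : Bornology.IsBounded Ω) :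
    Integrable (fun p : Vec d × Vec d => ‖p.2 - p.1‖⁻¹)
      ((volume.restrict Ω).prod (volume.restrict Ω)) := by
  have := isFiniteMeasure_restrict_of_isBounded hΩ
  obtain ⟨C, hC⟩ := exists_integral_inv_norm_sub_le hd hΩm hΩ
  have hm : Measurable fun p : Vec d × Vec d => ‖p.2 - p.1‖⁻¹ := by fun_prop
  refine (integrable_prod_iff hm.aestronglyMeasurable).2 ⟨?_, ?_⟩
  · filter_upwards [ae_restrict_mem hΩm] with x hx using (hC x hx).1
  · refine Integrable.of_bound
      hm.stronglyMeasurable.norm.integral_prod_right'.aestronglyMeasurable C ?_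
    filter_upwards [ae_restrict_mem hΩm] with x hx
    simp only [norm_inv, norm_norm]
    rw [Real.norm_of_nonneg (integral_nonneg fun y => by positivity)]
    exact (hC x hx).2

/-- Dominates the force singularity r^(-1/2) by the integrable 1 + r⁻¹; at r = 0 both inverses are 0
by convention. -/
theorem sqrt_mul_inv_le {r : ℝ} (hr : 0 ≤ r) : √r * r⁻¹ ≤ 1 + r⁻¹ := by
  rcases hr.eq_or_lt with rfl | hr
  · simp
  · rw [← sub_nonneg]
    have h1 : 0 < √r := Real.sqrt_pos.2 hr
    have h2 : √r ≤ 1 + r := by nlinarith [Real.sq_sqrt hr.le, sq_nonneg (√r - 1)]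
    have : 1 + r⁻¹ - √r * r⁻¹ = (1 + r - √r) * r⁻¹ := by field_simp; ring
    rw [this]
    exact mul_nonneg (by linarith) (by positivity)

/-- The weight of a bond in the energy, as a function of the bond vector. -/
def bondWeight (ε : ℝ) (J : ℝ → ℝ) (z : Vec d) : ℝ :=
  if ‖z‖ < ε then ‖z‖ * (J (‖z‖ / ε) / (ε ^ (d + 1) * unitBallVolume d * ‖z‖)) else 0

/-- The force that the point `y` exerts on the point `x`, up to a factor `2`. -/
def bondForce (ε : ℝ) (J g : ℝ → ℝ) (u : Vec d → Vec d) (y x : Vec d) : Vec d :=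
  (bondWeight ε J (y - x) * deriv g (scaledStrain y x u) * (√‖y - x‖ * ‖y - x‖⁻¹)) •
    unitVec y x

theorem unitBallVolume_pos (d : ℕ) : 0 < unitBallVolume d :=
  ENNReal.toReal_pos (Metric.measure_ball_pos volume _ one_pos).ne' measure_ball_lt_top.ne

theorem norm_unitVec_le (y x : Vec d) : ‖unitVec y x‖ ≤ 1 := by
  rw [unitVec, norm_smul, norm_inv, norm_norm]
  exact inv_mul_le_one

theorem unitVec_comm (y x : Vec d) : unitVec x y = -unitVec y x := by
  rw [unitVec, unitVec, norm_sub_rev, ← smul_neg, neg_sub]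

theorem bondWeight_neg (ε : ℝ) (J : ℝ → ℝ) (z : Vec d) :
    bondWeight ε J (-z) = bondWeight ε J z := by
  simp [bondWeight]

theorem bondWeight_nonneg {ε : ℝ} (hε : 0 < ε) {J : ℝ → ℝ} (hJ : IsInfluenceFunction J)
    (z : Vec d) : 0 ≤ bondWeight ε J z := by
  have := unitBallVolume_pos d
  have := hJ.nonneg (‖z‖ / ε)
  unfold bondWeight
  split_ifs <;> positivity

theorem exists_bondWeight_le {ε : ℝ} (hε : 0 < ε) {J : ℝ → ℝ} (hJ : IsInfluenceFunction J) :
    ∃ M, 0 ≤ M ∧ ∀ z : Vec d, bondWeight ε J z ≤ M := by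
  obtain ⟨M, hM⟩ := hJ.bounded
  have hM0 : 0 ≤ M := (hJ.nonneg 0).trans (hM 0)
  have hω := unitBallVolume_pos d
  refine ⟨M / (ε ^ (d + 1) * unitBallVolume d), by positivity, fun z => ?_⟩
  unfold bondWeight
  split_ifs with h
  · rcases eq_or_ne ‖z‖ 0 with h0 | h0
    · rw [h0, zero_mul]; positivity
    · rw [← div_div, mul_div_cancel₀ _ h0]
      have := hM (‖z‖ / ε)
      gcongr
  · positivity

/-- Serves the equality case: where the weight is positive, a vanishing weighted remainder vanishes
itself. The origin is excluded because the weight is 0 there. -/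
theorem exists_bondWeight_pos {ε : ℝ} (hε : 0 < ε) {J : ℝ → ℝ} (hJ : IsInfluenceFunction J) :
    ∃ η > 0, ∀ z : Vec d, z ≠ 0 → ‖z‖ < η → ‖z‖ < ε ∧ 0 < bondWeight ε J z := by
  obtain ⟨δ, hδ, hpos⟩ := hJ.pos
  refine ⟨min ε (ε * δ), by positivity, fun z hz hlt => ?_⟩
  have hz' : 0 < ‖z‖ := norm_pos_iff.2 hz
  have h1 : ‖z‖ < ε := hlt.trans_le (min_le_left _ _)
  have h2 : ‖z‖ < ε * δ := hlt.trans_le (min_le_right _ _)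
  have hω := unitBallVolume_pos d
  have hJp : 0 < J (‖z‖ / ε) :=
    hpos _ ⟨by positivity, by rw [div_lt_iff₀ hε]; linarith⟩
  refine ⟨h1, ?_⟩
  rw [bondWeight, if_pos h1]
  positivity

theorem measurable_bondWeight (ε : ℝ) {J : ℝ → ℝ} (hJ : IsInfluenceFunction J) :
    Measurable (bondWeight ε J : Vec d → ℝ) := by
  have := hJ.measurable
  unfold bondWeight
  refine Measurable.ite (measurableSet_lt measurable_norm measurable_const) ?_ measurable_const
  fun_prop

theorem measurable_unitVec : Measurable fun p : Vec d × Vec d => unitVec p.2 p.1 := by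
  unfold unitVec
  fun_prop

theorem measurable_scaledStrain {u : Vec d → Vec d} (hu : Measurable u) :
    Measurable fun p : Vec d × Vec d => scaledStrain p.2 p.1 u := by
  have := measurable_unitVec (d := d)
  unfold scaledStrain strain
  fun_prop

theorem scaledStrain_comm (y x : Vec d) (u : Vec d → Vec d) :
    scaledStrain x y u = scaledStrain y x u := by
  rw [scaledStrain, scaledStrain, strain, strain, unitVec_comm, norm_sub_rev x y, inner_neg_right,
    ← inner_neg_left, ← smul_neg, neg_sub]

theorem scaledStrain_sub (y x : Vec d) (v u : Vec d → Vec d) :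
    scaledStrain y x (fun z => v z - u z) = scaledStrain y x v - scaledStrain y x u := by
  simp only [scaledStrain, strain]
  rw [← mul_sub, ← inner_sub_left, ← smul_sub, sub_sub_sub_comm]

/-- The scaling by √|y - x| pays off here: it cancels one of the two inverse powers in the squared
difference quotient, leaving an integrable singularity. -/
theorem scaledStrain_sq_le (y x : Vec d) (w : Vec d → Vec d) :
    scaledStrain y x w ^ 2 ≤ ‖w y - w x‖ ^ 2 * ‖y - x‖⁻¹ := by
  rw [scaledStrain, mul_pow, Real.sq_sqrt (norm_nonneg _)]
  have h : |strain y x w| ≤ ‖y - x‖⁻¹ * ‖w y - w x‖ := by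
    refine (abs_real_inner_le_norm _ _).trans ?_
    rw [norm_smul, norm_inv, norm_norm]
    exact mul_le_of_le_one_right (by positivity) (norm_unitVec_le y x)
  have h2 : strain y x w ^ 2 ≤ (‖y - x‖⁻¹ * ‖w y - w x‖) ^ 2 := by
    rw [← sq_abs]; gcongr
  refine (mul_le_mul_of_nonneg_left h2 (norm_nonneg _)).trans (le_of_eq ?_)
  rcases eq_or_ne ‖y - x‖ 0 with h0 | h0
  · simp [h0]
  · field_simp

theorem measurable_bondForce (ε : ℝ) {J : ℝ → ℝ} (hJ : IsInfluenceFunction J) (g : ℝ → ℝ)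
    {u : Vec d → Vec d} (hu : Measurable u) :
    Measurable fun p : Vec d × Vec d => bondForce ε J g u p.2 p.1 := by
  have h1 := measurable_unitVec (d := d)
  have h2 := measurable_bondWeight (d := d) ε hJ
  have h3 := (measurable_deriv g).comp (measurable_scaledStrain hu)
  simp only [Function.comp_def] at h3
  unfold bondForce
  fun_prop

/-- Action equals reaction; this drives the nonlocal integration by parts. -/
theorem bondForce_comm (ε : ℝ) (J g : ℝ → ℝ) (u : Vec d → Vec d) (y x : Vec d) :
    bondForce ε J g u x y = -bondForce ε J g u y x := by
  rw [bondForce, bondForce, scaledStrain_comm, unitVec_comm, norm_sub_rev x y, ← neg_sub y x,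
    bondWeight_neg, smul_neg]

theorem inner_bondForce (ε : ℝ) (J g : ℝ → ℝ) (u w : Vec d → Vec d) (y x : Vec d) :
    inner ℝ (bondForce ε J g u y x) (w y - w x) =
      bondWeight ε J (y - x) * (deriv g (scaledStrain y x u) * scaledStrain y x w) := by
  simp only [bondForce, scaledStrain, strain, real_inner_smul_left]
  rw [real_inner_comm (w y - w x)]
  ring

theorem exists_norm_bondForce_le {ε : ℝ} (hε : 0 < ε) {J : ℝ → ℝ} (hJ : IsInfluenceFunction J)
    {g : ℝ → ℝ} {re rc : ℝ} (hg : IsCohesivePotential g re rc) :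
    ∃ M, 0 ≤ M ∧ ∀ (u : Vec d → Vec d) (y x : Vec d),
      ‖bondForce ε J g u y x‖ ≤ M * (1 + ‖y - x‖⁻¹) := by
  obtain ⟨M₁, hM₁, h₁⟩ := exists_bondWeight_le (d := d) hε hJ
  obtain ⟨M₂, h₂⟩ := hg.bounded_deriv
  have hM₂ : 0 ≤ M₂ := (abs_nonneg _).trans (h₂ 0)
  refine ⟨M₁ * M₂, by positivity, fun u y x => ?_⟩
  have h3 := sqrt_mul_inv_le (norm_nonneg (y - x))
  have h4 := bondWeight_nonneg hε hJ (y - x)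
  have h5 := h₁ (y - x)
  have h6 := h₂ (scaledStrain y x u)
  rw [bondForce, norm_smul, norm_mul, norm_mul, Real.norm_of_nonneg h4, Real.norm_eq_abs,
    Real.norm_of_nonneg (by positivity : (0:ℝ) ≤ √‖y - x‖ * ‖y - x‖⁻¹)]
  refine (mul_le_of_le_one_right (by positivity) (norm_unitVec_le y x)).trans ?_
  gcongr

end Kernel

/-! ### First order expansion of the potential energy. -/

section Energy

variable {Ω : Set (Vec d)} {ε : ℝ} {J g : ℝ → ℝ}

/-- With the cut-off at distance ε moved into the weight, the domain becomes the fixed product Ω ×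
Ω, on which Fubini and the swap of variables apply. -/
theorem potentialEnergy_eq (Ω : Set (Vec d)) (ε : ℝ) (J g : ℝ → ℝ) (u : Vec d → Vec d) :
    potentialEnergy Ω ε J g u =
      ∫ x in Ω, ∫ y in Ω, bondWeight ε J (y - x) * g (scaledStrain y x u) := by
  unfold potentialEnergy
  congr 1 with x
  rw [← Measure.restrict_restrict measurableSet_ball, ← integral_indicator measurableSet_ball]
  congr 1 with y
  by_cases h : ‖y - x‖ < ε
  · rw [indicator_of_mem (by rwa [mem_ball_iff_norm]), bondWeight, if_pos h, pairPotential]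
    exact (mul_assoc _ _ _).symm
  · rw [indicator_of_notMem (by rwa [mem_ball_iff_norm]), bondWeight, if_neg h, zero_mul]

/-- Off the diagonal √r · r⁻¹ = 1/√r; on it both integrands vanish because `unitVec` does. -/
theorem forceOp_eq (Ω : Set (Vec d)) (ε : ℝ) (J g : ℝ → ℝ) (u : Vec d → Vec d) (x : Vec d) :
    forceOp Ω ε J g u x = -((2 : ℝ) • ∫ y in Ω, bondForce ε J g u y x) := by
  unfold forceOp
  rw [← Measure.restrict_restrict measurableSet_ball, ← integral_indicator measurableSet_ball,
    ← integral_smul]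
  congr 2
  funext y
  by_cases h : ‖y - x‖ < ε
  · rw [indicator_of_mem (by rwa [mem_ball_iff_norm]), bondForce, bondWeight, if_pos h, smul_smul]
    rcases eq_or_ne ‖y - x‖ 0 with h0 | h0
    · simp [unitVec, h0]
    · congr 1
      have h1 : √‖y - x‖ ≠ 0 := by positivity
      have h2 : ‖y - x‖ = √‖y - x‖ * √‖y - x‖ := (Real.mul_self_sqrt (norm_nonneg _)).symm
      have h3 : (√‖y - x‖)⁻¹ = √‖y - x‖ * ‖y - x‖⁻¹ := by
        rw [eq_mul_inv_iff_mul_eq₀ h0, inv_mul_eq_iff_eq_mul₀ h1]; exact h2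
      rw [← div_div (J _) _ √‖y - x‖, div_eq_mul_inv _ √‖y - x‖, h3, ← div_div (J _) _ ‖y - x‖,
        mul_div_cancel₀ _ h0]
      ring
  · rw [indicator_of_notMem (by rwa [mem_ball_iff_norm]), bondForce, bondWeight, if_neg h]
    simp

theorem integrable_bondForce (hd : 2 ≤ d) (hΩm : MeasurableSet Ω) (hΩ : Bornology.IsBounded Ω)
    (hε : 0 < ε) (hJ : IsInfluenceFunction J) {re rc : ℝ} (hg : IsCohesivePotential g re rc)
    {u : Vec d → Vec d} (hu : Measurable u) :
    Integrable (fun p : Vec d × Vec d => bondForce ε J g u p.2 p.1)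
      ((volume.restrict Ω).prod (volume.restrict Ω)) := by
  have := isFiniteMeasure_restrict_of_isBounded hΩ
  obtain ⟨M, -, hM⟩ := exists_norm_bondForce_le (d := d) hε hJ hg
  exact Integrable.mono'
    (((integrable_const 1).add (integrable_inv_norm_sub_prod hd hΩm hΩ)).const_mul M)
    (measurable_bondForce ε hJ g hu).aestronglyMeasurable
    (Eventually.of_forall fun p => hM u p.2 p.1)

theorem measurable_forceOp (Ω : Set (Vec d)) (ε : ℝ) (hJ : IsInfluenceFunction J) (g : ℝ → ℝ)
    {u : Vec d → Vec d} (hu : Measurable u) : Measurable (forceOp Ω ε J g u) := by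
  have h := (measurable_bondForce ε hJ g hu).stronglyMeasurable.integral_prod_right'
    (ν := volume.restrict Ω)
  have h2 : forceOp Ω ε J g u = fun x => -((2 : ℝ) • ∫ y in Ω, bondForce ε J g u y x) :=
    funext fun x => forceOp_eq Ω ε J g u x
  rw [h2]
  exact (h.measurable.const_smul (2 : ℝ)).neg

/-- Makes the force an L^∞ field, so that the residual can serve as a test field. -/
theorem exists_norm_forceOp_le (hd : 2 ≤ d) (hΩm : MeasurableSet Ω)
    (hΩ : Bornology.IsBounded Ω) (hε : 0 < ε) (hJ : IsInfluenceFunction J) {re rc : ℝ}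
    (hg : IsCohesivePotential g re rc) (u : Vec d → Vec d) :
    ∃ C, ∀ x ∈ Ω, ‖forceOp Ω ε J g u x‖ ≤ C := by
  have := isFiniteMeasure_restrict_of_isBounded hΩ
  obtain ⟨M, hM0, hM⟩ := exists_norm_bondForce_le (d := d) hε hJ hg
  obtain ⟨C, hC⟩ := exists_integral_inv_norm_sub_le hd hΩm hΩ
  refine ⟨2 * (M * ((volume.restrict Ω).real univ + C)), fun x hx => ?_⟩
  rw [forceOp_eq, norm_neg, norm_smul, Real.norm_ofNat]
  have hi : Integrable (fun y => 1 + ‖y - x‖⁻¹) (volume.restrict Ω) :=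
    (integrable_const 1).add (hC x hx).1
  have h1 : ‖∫ y in Ω, bondForce ε J g u y x‖ ≤ ∫ y in Ω, M * (1 + ‖y - x‖⁻¹) :=
    norm_integral_le_of_norm_le (hi.const_mul M) (Eventually.of_forall fun y => hM u y x)
  rw [integral_const_mul, integral_add (integrable_const 1) (hC x hx).1, integral_const,
    smul_eq_mul, mul_one] at h1
  have h2 := (hC x hx).2
  refine mul_le_mul_of_nonneg_left (h1.trans ?_) zero_le_two
  gcongr

/-- The first variation of the potential energy is represented by the force operator. -/
theorem integral_first_variation (hd : 2 ≤ d) (hΩm : MeasurableSet Ω)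
    (hΩ : Bornology.IsBounded Ω) (hε : 0 < ε) (hJ : IsInfluenceFunction J) {re rc : ℝ}
    (hg : IsCohesivePotential g re rc) {u w : Vec d → Vec d} (hu : Measurable u)
    (hw : Measurable w) {C : ℝ} (hC : ∀ᵐ x ∂volume.restrict Ω, ‖w x‖ ≤ C) :
    Integrable (fun p : Vec d × Vec d => bondWeight ε J (p.2 - p.1) *
        (deriv g (scaledStrain p.2 p.1 u) * scaledStrain p.2 p.1 w))
      ((volume.restrict Ω).prod (volume.restrict Ω)) ∧
    ∫ p, bondWeight ε J (p.2 - p.1) *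
        (deriv g (scaledStrain p.2 p.1 u) * scaledStrain p.2 p.1 w)
      ∂((volume.restrict Ω).prod (volume.restrict Ω)) =
      ∫ x in Ω, inner ℝ (forceOp Ω ε J g u x) (w x) := by
  have := isFiniteMeasure_restrict_of_isBounded hΩ
  set μ := volume.restrict Ω with hμ
  have hF := integrable_bondForce hd hΩm hΩ hε hJ hg hu
  rw [← hμ] at hF
  have h1 : Integrable (fun p : Vec d × Vec d => inner ℝ (bondForce ε J g u p.2 p.1) (w p.1))
      (μ.prod μ) := by
    refine (hF.norm.mul_const C).mono'
      (hF.1.inner (hw.comp measurable_fst).aestronglyMeasurable) ?_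
    filter_upwards [Measure.quasiMeasurePreserving_fst.ae hC] with p hp
    exact (norm_inner_le_norm _ _).trans (mul_le_mul_of_nonneg_left hp (norm_nonneg _))
  -- Exchanging x and y turns the term with w y into minus the term with w x. The two add up to -2
  -- times the latter, matching the factor -2 in `forceOp_eq`.
  have hswap : ∀ p : Vec d × Vec d, inner ℝ (bondForce ε J g u p.2 p.1) (w p.2) =
      -(fun q : Vec d × Vec d => inner ℝ (bondForce ε J g u q.2 q.1) (w q.1)) p.swap := by
    intro p
    simp only [Prod.fst_swap, Prod.snd_swap]
    rw [bondForce_comm ε J g u p.2 p.1, inner_neg_left, neg_neg]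
  have h2 : Integrable (fun p : Vec d × Vec d => inner ℝ (bondForce ε J g u p.2 p.1) (w p.2))
      (μ.prod μ) := by
    simp only [hswap]
    exact h1.swap.neg
  have hdecomp : (fun p : Vec d × Vec d => bondWeight ε J (p.2 - p.1) *
        (deriv g (scaledStrain p.2 p.1 u) * scaledStrain p.2 p.1 w)) = fun p =>
      inner ℝ (bondForce ε J g u p.2 p.1) (w p.2) -
        inner ℝ (bondForce ε J g u p.2 p.1) (w p.1) := by
    funext p
    rw [← inner_bondForce, inner_sub_right]
  rw [hdecomp]
  refine ⟨h2.sub h1, ?_⟩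
  rw [integral_sub h2 h1]
  have h3 : ∫ p, inner ℝ (bondForce ε J g u p.2 p.1) (w p.2) ∂μ.prod μ =
      -∫ p, inner ℝ (bondForce ε J g u p.2 p.1) (w p.1) ∂μ.prod μ := by
    rw [← integral_prod_swap, ← integral_neg]
    congr 1 with p
    rw [hswap p.swap, Prod.swap_swap]
  rw [h3, integral_prod _ h1, ← neg_add', ← two_mul, ← integral_const_mul, ← integral_neg]
  refine integral_congr_ae ?_
  filter_upwards [hF.prod_right_ae] with x hx
  rw [forceOp_eq, inner_neg_left, real_inner_smul_left, real_inner_comm, ← integral_inner hx]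
  simp only [real_inner_comm]

/-- The remainder of the first order expansion of the potential energy. -/
theorem potentialEnergy_sub_sub (hd : 2 ≤ d) (hΩm : MeasurableSet Ω)
    (hΩ : Bornology.IsBounded Ω) (hε : 0 < ε) (hJ : IsInfluenceFunction J) {re rc : ℝ}
    (hg : IsCohesivePotential g re rc) {u v : Vec d → Vec d} (hu : Measurable u)
    (hv : Measurable v) {C : ℝ} (hC : ∀ᵐ x ∂volume.restrict Ω, ‖v x - u x‖ ≤ C) :
    Integrable (fun p : Vec d × Vec d => bondWeight ε J (p.2 - p.1) *
        (g (scaledStrain p.2 p.1 v) - g (scaledStrain p.2 p.1 u) -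
          deriv g (scaledStrain p.2 p.1 u) * (scaledStrain p.2 p.1 v - scaledStrain p.2 p.1 u)))
      ((volume.restrict Ω).prod (volume.restrict Ω)) ∧
    potentialEnergy Ω ε J g v - potentialEnergy Ω ε J g u -
        ∫ x in Ω, inner ℝ (forceOp Ω ε J g u x) (v x - u x) =
      ∫ p, bondWeight ε J (p.2 - p.1) *
        (g (scaledStrain p.2 p.1 v) - g (scaledStrain p.2 p.1 u) -
          deriv g (scaledStrain p.2 p.1 u) * (scaledStrain p.2 p.1 v - scaledStrain p.2 p.1 u))
        ∂((volume.restrict Ω).prod (volume.restrict Ω)) := by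
  have := isFiniteMeasure_restrict_of_isBounded hΩ
  obtain ⟨h1, h2⟩ := integral_first_variation hd hΩm hΩ hε hJ hg hu (hv.sub hu) hC
  obtain ⟨M₁, hM₁, hb₁⟩ := exists_bondWeight_le (d := d) hε hJ
  obtain ⟨M₂, hb₂⟩ := hg.bounded_self
  have hM₂ : 0 ≤ M₂ := (abs_nonneg _).trans (hb₂ 0)
  have hint : ∀ {f : Vec d → Vec d}, Measurable f → Integrable (fun p : Vec d × Vec d =>
      bondWeight ε J (p.2 - p.1) * g (scaledStrain p.2 p.1 f))
      ((volume.restrict Ω).prod (volume.restrict Ω)) := by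
    intro f hf
    have hm : Measurable (fun p : Vec d × Vec d =>
        bondWeight ε J (p.2 - p.1) * g (scaledStrain p.2 p.1 f)) :=
      ((measurable_bondWeight ε hJ).comp (measurable_snd.sub measurable_fst)).mul
        (hg.differentiable_self.continuous.measurable.comp (measurable_scaledStrain hf))
    refine Integrable.of_bound hm.aestronglyMeasurable (M₁ * M₂) (Eventually.of_forall fun p => ?_)
    rw [norm_mul, Real.norm_of_nonneg (bondWeight_nonneg hε hJ _)]
    exact mul_le_mul (hb₁ _) (hb₂ _) (abs_nonneg _) hM₁
  have hpe : ∀ {f : Vec d → Vec d}, Measurable f → potentialEnergy Ω ε J g f =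
      ∫ p, bondWeight ε J (p.2 - p.1) * g (scaledStrain p.2 p.1 f)
        ∂((volume.restrict Ω).prod (volume.restrict Ω)) := by
    intro f hf
    rw [potentialEnergy_eq, integral_prod _ (hint hf)]
  have hdecomp : (fun p : Vec d × Vec d => bondWeight ε J (p.2 - p.1) *
        (g (scaledStrain p.2 p.1 v) - g (scaledStrain p.2 p.1 u) -
          deriv g (scaledStrain p.2 p.1 u) *
            (scaledStrain p.2 p.1 v - scaledStrain p.2 p.1 u))) = fun p =>
      bondWeight ε J (p.2 - p.1) * g (scaledStrain p.2 p.1 v) -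
        bondWeight ε J (p.2 - p.1) * g (scaledStrain p.2 p.1 u) -
        bondWeight ε J (p.2 - p.1) * (deriv g (scaledStrain p.2 p.1 u) *
          scaledStrain p.2 p.1 (fun x => v x - u x)) := by
    funext p
    rw [scaledStrain_sub]
    ring
  rw [hdecomp]
  have h3 := (hint hv).sub (hint hu)
  refine ⟨h3.sub h1, ?_⟩
  have e1 := integral_sub h3 h1
  have e2 := integral_sub (hint hv) (hint hu)
  simp only [Pi.sub_apply, Pi.sub_def] at e1 e2 h2
  rw [e1, e2, h2, hpe hu, hpe hv]

/-- The remainder of the first order expansion of the potential energy is quadratic in the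
`L^∞` norm of the increment. -/
theorem exists_abs_potentialEnergy_sub_sub_le (hd : 2 ≤ d) (hΩm : MeasurableSet Ω)
    (hΩ : Bornology.IsBounded Ω) (hε : 0 < ε) (hJ : IsInfluenceFunction J) {re rc : ℝ}
    (hg : IsCohesivePotential g re rc) :
    ∃ K, ∀ {u v : Vec d → Vec d}, Measurable u → Measurable v → ∀ {C : ℝ},
      (∀ᵐ x ∂volume.restrict Ω, ‖v x - u x‖ ≤ C) →
      |potentialEnergy Ω ε J g v - potentialEnergy Ω ε J g u -
        ∫ x in Ω, inner ℝ (forceOp Ω ε J g u x) (v x - u x)| ≤ K * C ^ 2 := by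
  have := isFiniteMeasure_restrict_of_isBounded hΩ
  obtain ⟨M, hM, hb⟩ := exists_bondWeight_le (d := d) hε hJ
  have hG : 0 ≤ iteratedDeriv 2 g 0 := (abs_nonneg _).trans (hg.second_deriv_max 0)
  -- M bounds the weight, g''(0) comes from Taylor, 4 from ‖w y - w x‖ ≤ 2C squared, and the
  -- integral from the squared strain.
  refine ⟨M * (iteratedDeriv 2 g 0 * 4) * ∫ p, ‖p.2 - p.1‖⁻¹
    ∂((volume.restrict Ω).prod (volume.restrict Ω)), fun {u v} hu hv {C} hC => ?_⟩
  rw [(potentialEnergy_sub_sub hd hΩm hΩ hε hJ hg hu hv hC).2, mul_right_comm,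
    ← integral_const_mul, ← Real.norm_eq_abs]
  refine norm_integral_le_of_norm_le
    ((integrable_inv_norm_sub_prod hd hΩm hΩ).const_mul _) ?_
  filter_upwards [Measure.quasiMeasurePreserving_fst.ae hC,
    Measure.quasiMeasurePreserving_snd.ae hC] with p h1 h2
  rw [norm_mul, Real.norm_of_nonneg (bondWeight_nonneg hε hJ _), Real.norm_eq_abs]
  have h3 := hg.abs_taylor_le (scaledStrain p.2 p.1 u) (scaledStrain p.2 p.1 v)
  rw [← scaledStrain_sub] at h3
  have h4 := scaledStrain_sq_le p.2 p.1 (fun x => v x - u x)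
  have h5 : ‖(v p.2 - u p.2) - (v p.1 - u p.1)‖ ^ 2 ≤ (2 * C) ^ 2 := by
    have := norm_sub_le (v p.2 - u p.2) (v p.1 - u p.1)
    gcongr
    linarith
  rw [← scaledStrain_sub]
  calc _ ≤ M * (iteratedDeriv 2 g 0 * ((2 * C) ^ 2 * ‖p.2 - p.1‖⁻¹)) := by
        refine mul_le_mul (hb _) (h3.trans ?_) (abs_nonneg _) hM
        refine mul_le_mul_of_nonneg_left (h4.trans ?_) hG
        exact mul_le_mul_of_nonneg_right h5 (by positivity)
    _ = _ := by ring

end Energy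

/-! ### Fields of vanishing strain are rigid motions. -/

section Rigidity

theorem inner_toEuclideanLin_self_of_skew {Q : Matrix (Fin d) (Fin d) ℝ} (hQ : Q.transpose = -Q)
    (z : Vec d) : inner ℝ (Matrix.toEuclideanLin Q z) z = 0 := by
  have h : LinearMap.adjoint (Matrix.toEuclideanLin Q) = -Matrix.toEuclideanLin Q := by
    rw [← Matrix.toEuclideanLin_conjTranspose_eq_adjoint,
      Matrix.conjTranspose_eq_transpose_of_trivial, hQ, map_neg]
  have h2 := LinearMap.adjoint_inner_right (Matrix.toEuclideanLin Q) z z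
  rw [h, LinearMap.neg_apply, inner_neg_right, real_inner_comm] at h2
  linarith

/-- An affine map whose linear part has vanishing quadratic form is an infinitesimal rigid
motion. -/
theorem mem_rigidMotions_of_inner_self (A : Vec d →ₗ[ℝ] Vec d) (c : Vec d)
    (hA : ∀ z, inner ℝ (A z) z = 0) : (fun x => A x + c) ∈ rigidMotions d := by
  refine ⟨Matrix.toEuclideanLin.symm A, c, ?_, by simp⟩
  -- Polarization: the quadratic form at x + y.
  have h : -A = LinearMap.adjoint A := by
    rw [LinearMap.eq_adjoint_iff]
    intro x y
    have h1 := hA (x + y)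
    rw [map_add, inner_add_left, inner_add_right, inner_add_right, hA x, hA y] at h1
    rw [LinearMap.neg_apply, inner_neg_left, real_inner_comm (A y) x]
    linarith
  apply Matrix.toEuclideanLin.injective
  rw [← Matrix.conjTranspose_eq_transpose_of_trivial,
    Matrix.toEuclideanLin_conjTranspose_eq_adjoint, map_neg, LinearEquiv.apply_symm_apply, h]

theorem continuous_of_mem_rigidMotions {ρ : Vec d → Vec d} (hρ : ρ ∈ rigidMotions d) :
    Continuous ρ := by
  obtain ⟨Q, c, -, rfl⟩ := hρ
  exact (LinearMap.continuous_of_finiteDimensional _).add continuous_const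

theorem analyticOnNhd_of_mem_rigidMotions {ρ : Vec d → Vec d} (hρ : ρ ∈ rigidMotions d) :
    AnalyticOnNhd ℝ ρ univ := by
  obtain ⟨Q, c, -, rfl⟩ := hρ
  intro x _
  exact ((Matrix.toEuclideanLin Q).toContinuousLinearMap.analyticAt x).add analyticAt_const

theorem scaledStrain_of_mem_rigidMotions {ρ : Vec d → Vec d} (hρ : ρ ∈ rigidMotions d)
    (y x : Vec d) : scaledStrain y x ρ = 0 := by
  obtain ⟨Q, c, hQ, rfl⟩ := hρ
  rw [scaledStrain, strain, unitVec, add_sub_add_right_eq_sub, ← map_sub, real_inner_smul_left,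
    real_inner_smul_right, inner_toEuclideanLin_self_of_skew hQ]
  simp

/-- Continuity upgrades a.e. equality to equality on U, and the identity theorem for analytic maps
extends it. Used to glue local rigid motions. -/
theorem rigidMotions_eq_of_ae_eq {ρ σ : Vec d → Vec d} (hρ : ρ ∈ rigidMotions d)
    (hσ : σ ∈ rigidMotions d) {U : Set (Vec d)} (hU : IsOpen U) (hne : U.Nonempty)
    (h : ρ =ᵐ[volume.restrict U] σ) : ρ = σ := by
  obtain ⟨x, hx⟩ := hne
  have h1 := Measure.eqOn_open_of_ae_eq h hU (continuous_of_mem_rigidMotions hρ).continuousOn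
    (continuous_of_mem_rigidMotions hσ).continuousOn
  exact (analyticOnNhd_of_mem_rigidMotions hρ).eq_of_eventuallyEq
    (analyticOnNhd_of_mem_rigidMotions hσ) (h1.eventuallyEq_of_mem (hU.mem_nhds hx))

/-- A field with `(w y - w x) ⬝ (y - x) = 0` for almost all pairs of points of an open set is
almost everywhere affine. -/
theorem exists_affine_of_ae_inner_eq_zero {w : Vec d → Vec d} {B : Set (Vec d)} (hB : IsOpen B)
    (hne : B.Nonempty) (h : ∀ᵐ x ∂volume.restrict B, ∀ᵐ y ∂volume.restrict B,
      inner ℝ (w y - w x) (y - x) = 0) :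
    ∃ (A : Vec d →ₗ[ℝ] Vec d) (c : Vec d), w =ᵐ[volume.restrict B] fun x => A x + c := by
  -- The directions along which the component of w is a.e. affine.
  let M : Submodule ℝ (Vec d) :=
    { carrier := {v | ∃ (l : Vec d →ₗ[ℝ] ℝ) (c : ℝ),
        ∀ᵐ y ∂volume.restrict B, inner ℝ (w y) v = l y + c}
      zero_mem' := ⟨0, 0, by simp⟩
      add_mem' := by
        rintro v v' ⟨l, c, h1⟩ ⟨l', c', h2⟩
        refine ⟨l + l', c + c', ?_⟩
        filter_upwards [h1, h2] with y e1 e2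
        rw [inner_add_right, e1, e2, LinearMap.add_apply]
        ring
      smul_mem' := by
        rintro a v ⟨l, c, h1⟩
        refine ⟨a • l, a * c, ?_⟩
        filter_upwards [h1] with y e1
        rw [real_inner_smul_right, e1, LinearMap.smul_apply, smul_eq_mul]
        ring }
  have hneBot : (ae (volume.restrict B)).NeBot := by
    rw [ae_neBot, Ne, Measure.restrict_eq_zero]
    exact (hB.measure_pos volume hne).ne'
  obtain ⟨p₀, hp₀⟩ := h.exists
  -- Subtracting the identities based at p and p₀ cancels ⟨w y, y⟩ and leaves ⟨w y, p - p₀⟩ affine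
  -- in y.
  have hmem : ∀ p, (∀ᵐ y ∂volume.restrict B, inner ℝ (w y - w p) (y - p) = 0) → p - p₀ ∈ M := by
    intro p hp
    refine ⟨innerₛₗ ℝ (w p₀ - w p), inner ℝ (w p) p - inner ℝ (w p₀) p₀, ?_⟩
    filter_upwards [hp, hp₀] with y e1 e2
    simp only [inner_sub_left, inner_sub_right, innerₛₗ_apply_apply] at e1 e2 ⊢
    linarith
  -- Almost every point of B lies in p₀ + M; were M proper, this affine subspace would be null,
  -- whereas B has positive measure.
  have htop : M = ⊤ := by
    by_contra hM
    have hne : AffineSubspace.mk' p₀ M ≠ ⊤ := fun e => hM <| by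
      rw [← AffineSubspace.direction_mk' p₀ M, e, AffineSubspace.direction_top]
    have h0 := Measure.addHaar_affineSubspace volume _ hne
    have h1 : ∀ᵐ x ∂volume.restrict B, x ∈ (AffineSubspace.mk' p₀ M : Set (Vec d)) := by
      filter_upwards [h] with p hp
      exact AffineSubspace.mem_mk'.2 (hmem p hp)
    have h2 : ∀ᵐ x ∂volume.restrict B, x ∉ (AffineSubspace.mk' p₀ M : Set (Vec d)) :=
      ae_restrict_of_ae (measure_eq_zero_iff_ae_notMem.1 h0)
    obtain ⟨x, hx1, hx2⟩ := (h1.and h2).exists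
    exact hx2 hx1
  have hbasis : ∀ i, EuclideanSpace.single i (1 : ℝ) ∈ M := fun i => htop ▸ Submodule.mem_top
  choose l c hl using hbasis
  refine ⟨(WithLp.linearEquiv 2 ℝ (Fin d → ℝ)).symm.toLinearMap ∘ₗ LinearMap.pi l,
    WithLp.toLp 2 c, ?_⟩
  filter_upwards [ae_all_iff.2 hl] with y hy
  ext i
  have := hy i
  rw [EuclideanSpace.inner_single_right] at this
  simpa using this

/-- For one good base point x the form ⟨A(y - x), y - x⟩ vanishes for a.e. y ∈ B, by continuity for
all of them, and by homogeneity in every direction. -/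
theorem exists_rigidMotion_of_ae_inner_eq_zero {w : Vec d → Vec d} {B : Set (Vec d)}
    (hB : IsOpen B) (hne : B.Nonempty) (h : ∀ᵐ x ∂volume.restrict B, ∀ᵐ y ∂volume.restrict B,
      inner ℝ (w y - w x) (y - x) = 0) :
    ∃ ρ ∈ rigidMotions d, w =ᵐ[volume.restrict B] ρ := by
  obtain ⟨A, c, hA⟩ := exists_affine_of_ae_inner_eq_zero hB hne h
  refine ⟨_, mem_rigidMotions_of_inner_self A c fun z => ?_, hA⟩
  have hneBot : (ae (volume.restrict B)).NeBot := by
    rw [ae_neBot, Ne, Measure.restrict_eq_zero]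
    exact (hB.measure_pos volume hne).ne'
  obtain ⟨x, ⟨hx1, hx2⟩, hxB⟩ := ((h.and hA).and (ae_restrict_mem hB.measurableSet)).exists
  have hAc : Continuous A := LinearMap.continuous_of_finiteDimensional _
  have h1 : (fun y => inner ℝ (A (y - x)) (y - x)) =ᵐ[volume.restrict B] fun _ => (0 : ℝ) := by
    filter_upwards [hx1, hA] with y e1 e2
    rwa [e2, hx2, add_sub_add_right_eq_sub, ← map_sub] at e1
  have h2 := Measure.eqOn_open_of_ae_eq h1 hB (Continuous.continuousOn (by fun_prop))
    continuousOn_const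
  have h3 : Tendsto (fun t : ℝ => x + t • z) (𝓝[>] 0) (𝓝 x) := by
    have : Tendsto (fun t : ℝ => x + t • z) (𝓝 0) (𝓝 (x + (0 : ℝ) • z)) :=
      (by fun_prop : Continuous fun t : ℝ => x + t • z).tendsto 0
    rw [zero_smul, add_zero] at this
    exact this.mono_left nhdsWithin_le_nhds
  obtain ⟨t, ht, ht0⟩ := ((h3.eventually (hB.mem_nhds hxB)).and self_mem_nhdsWithin).exists
  have h4 := h2 ht
  simp only [add_sub_cancel_left, map_smul, real_inner_smul_left, real_inner_smul_right] at h4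
  have ht' : t ≠ 0 := ne_of_gt ht0
  simpa [ht'] using h4

/-- A field on a domain with `(w y - w x) ⬝ (y - x) = 0` for almost all pairs of nearby points is
almost everywhere an infinitesimal rigid motion. -/
theorem exists_rigidMotion_of_isConnected {w : Vec d → Vec d} {Ω : Set (Vec d)} (hΩ : IsOpen Ω)
    (hconn : IsConnected Ω) {η : ℝ} (hη : 0 < η)
    (h : ∀ᵐ x ∂volume.restrict Ω, ∀ᵐ y ∂volume.restrict Ω,
      ‖y - x‖ < η → inner ℝ (w y - w x) (y - x) = 0) :
    ∃ ρ ∈ rigidMotions d, w =ᵐ[volume.restrict Ω] ρ := by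
  have hloc : ∀ x ∈ Ω, ∃ r > 0, Metric.ball x r ⊆ Ω ∧
      ∃ ρ ∈ rigidMotions d, w =ᵐ[volume.restrict (Metric.ball x r)] ρ := by
    intro x hx
    obtain ⟨s, hs, hsub⟩ := Metric.isOpen_iff.1 hΩ x hx
    -- Radius at most η/2 keeps any two points of the ball within distance η.
    have hsub' : Metric.ball x (min s (η / 2)) ⊆ Ω :=
      (Metric.ball_subset_ball (min_le_left _ _)).trans hsub
    have hr : 0 < min s (η / 2) := by positivity
    refine ⟨_, hr, hsub', exists_rigidMotion_of_ae_inner_eq_zero Metric.isOpen_ball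
      ⟨x, Metric.mem_ball_self hr⟩ ?_⟩
    filter_upwards [ae_restrict_of_ae_restrict_of_subset hsub' h,
      ae_restrict_mem measurableSet_ball] with a ha hax
    filter_upwards [ae_restrict_of_ae_restrict_of_subset hsub' ha,
      ae_restrict_mem measurableSet_ball] with b hb hbx
    apply hb
    rw [← dist_eq_norm]
    have h1 := (Metric.mem_ball.1 hax).trans_le (min_le_right _ _)
    have h2 := (Metric.mem_ball.1 hbx).trans_le (min_le_right _ _)
    linarith [dist_triangle_right b a x]
  choose! r hr hsub ρ hρ hw using hloc
  -- `ρ` is locally constant, since overlapping balls share an open set on which both motions agree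
  -- a.e. with w; connectedness makes it constant.
  have hconst : ∀ x ∈ Ω, ∀ y ∈ Ω, ρ x = ρ y := by
    intro x hx y hy
    refine hconn.isPreconnected.induction₂ (fun x y => ρ x = ρ y) (fun x hx => ?_)
      (fun _ _ _ _ _ _ => Eq.trans) (fun _ _ _ _ => Eq.symm) hx hy
    filter_upwards [mem_nhdsWithin_of_mem_nhds (Metric.ball_mem_nhds x (hr x hx)),
      self_mem_nhdsWithin] with y hyx hy
    refine rigidMotions_eq_of_ae_eq (hρ x hx) (hρ y hy)
      (Metric.isOpen_ball.inter Metric.isOpen_ball)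
      (⟨y, hyx, Metric.mem_ball_self (hr y hy)⟩ :
        (Metric.ball x (r x) ∩ Metric.ball y (r y)).Nonempty) ?_
    filter_upwards [ae_restrict_of_ae_restrict_of_subset inter_subset_left (hw x hx),
      ae_restrict_of_ae_restrict_of_subset inter_subset_right (hw y hy)] with z h1 h2
    rw [← h1, h2]
  obtain ⟨x₀, hx₀⟩ := hconn.nonempty
  refine ⟨ρ x₀, hρ x₀ hx₀, ?_⟩
  rw [EventuallyEq, ae_restrict_iff' hΩ.measurableSet, ae_iff]
  refine measure_null_of_locally_null _ fun x hx => ?_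
  have hxΩ : x ∈ Ω := by
    by_contra hn
    exact hx fun hc => absurd hc hn
  refine ⟨_, inter_mem_nhdsWithin _ (Metric.ball_mem_nhds x (hr x hxΩ)), ?_⟩
  have := hw x hxΩ
  rw [EventuallyEq, ae_restrict_iff' measurableSet_ball, ae_iff] at this
  refine measure_mono_null ?_ this
  rintro y ⟨hy1, hy2⟩ hy3
  refine hy1 fun _ => ?_
  rw [hconst x₀ hx₀ x hxΩ]
  exact hy3 hy2

end Rigidity

/-! ### Fréchet derivative, Euler–Lagrange equation and minimality. -/

section CriticalPoints

variable {Ω : Set (Vec d)} {ε : ℝ} {J g : ℝ → ℝ}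

theorem ae_norm_le_norm (u : LInfty Ω) : ∀ᵐ x ∂volume.restrict Ω, ‖u x‖ ≤ ‖u‖ := by
  have h := ae_le_eLpNormEssSup (f := (u : Vec d → Vec d)) (μ := volume.restrict Ω)
  filter_upwards [h] with x hx
  rw [← eLpNorm_exponent_top] at hx
  rw [Lp.norm_def, ← toReal_enorm]
  exact ENNReal.toReal_mono (Lp.eLpNorm_ne_top u) hx

theorem ae_norm_sub_le_norm_sub (u v : LInfty Ω) :
    ∀ᵐ x ∂volume.restrict Ω, ‖v x - u x‖ ≤ ‖v - u‖ := by
  filter_upwards [ae_norm_le_norm (v - u), Lp.coeFn_sub v u] with x h1 h2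
  rwa [h2] at h1

theorem measurable_coe (u : LInfty Ω) : Measurable (u : Vec d → Vec d) :=
  (Lp.stronglyMeasurable u).measurable

theorem integrable_inner_lInfty (hΩ : Bornology.IsBounded Ω) (F w : LInfty Ω) :
    Integrable (fun x => inner ℝ (F x) (w x)) (volume.restrict Ω) := by
  have := isFiniteMeasure_restrict_of_isBounded hΩ
  refine Integrable.of_bound ((Lp.aestronglyMeasurable F).inner (Lp.aestronglyMeasurable w))
    (‖F‖ * ‖w‖) ?_
  filter_upwards [ae_norm_le_norm F, ae_norm_le_norm w] with x h1 h2
  exact (norm_inner_le_norm _ _).trans (mul_le_mul h1 h2 (norm_nonneg _) (norm_nonneg _))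

/-- The `L²` pairing with a bounded field, as a functional on `𝒱`. -/
def pairing (hΩ : Bornology.IsBounded Ω) (F : LInfty Ω) : dispSpace Ω →L[ℝ] ℝ :=
  LinearMap.mkContinuous
    { toFun := fun w => ∫ x in Ω, inner ℝ (F x) ((w : LInfty Ω) x)
      map_add' := by
        intro v w
        rw [← integral_add (integrable_inner_lInfty hΩ F v) (integrable_inner_lInfty hΩ F w)]
        refine integral_congr_ae ?_
        filter_upwards [Lp.coeFn_add (v : LInfty Ω) w] with x hx
        rw [Submodule.coe_add, hx, Pi.add_apply, inner_add_right]
      map_smul' := by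
        intro c w
        rw [RingHom.id_apply, smul_eq_mul, ← integral_const_mul]
        refine integral_congr_ae ?_
        filter_upwards [Lp.coeFn_smul c (w : LInfty Ω)] with x hx
        rw [Submodule.coe_smul, hx, Pi.smul_apply, real_inner_smul_right] }
    (‖F‖ * (volume.restrict Ω).real univ) (by
      intro w
      have := isFiniteMeasure_restrict_of_isBounded hΩ
      have h : ‖∫ x in Ω, inner ℝ (F x) ((w : LInfty Ω) x)‖ ≤
          (‖F‖ * ‖w‖) * (volume.restrict Ω).real univ := by
        refine norm_integral_le_of_norm_le_const ?_
        filter_upwards [ae_norm_le_norm F, ae_norm_le_norm (w : LInfty Ω)] with x h1 h2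
        exact (norm_inner_le_norm _ _).trans (mul_le_mul h1 h2 (norm_nonneg _) (norm_nonneg _))
      rw [mul_right_comm]
      exact h)

theorem pairing_apply (hΩ : Bornology.IsBounded Ω) (F : LInfty Ω) (w : dispSpace Ω) :
    pairing hΩ F w = ∫ x in Ω, inner ℝ (F x) ((w : LInfty Ω) x) := rfl

theorem ae_eq_zero_of_integral_inner_self {F : LInfty Ω} (hΩ : Bornology.IsBounded Ω)
    (h : ∫ x in Ω, inner ℝ (F x) (F x) = 0) : F =ᵐ[volume.restrict Ω] 0 := by
  have h1 := (integral_eq_zero_iff_of_nonneg (fun x => real_inner_self_nonneg)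
    (integrable_inner_lInfty hΩ F F)).1 h
  filter_upwards [h1] with x hx
  exact inner_self_eq_zero.1 hx

/-- The out-of-balance force `ℒ[u] - b` belongs to `𝒱`. -/
theorem exists_residual (hd : 2 ≤ d) (hΩm : MeasurableSet Ω)
    (hΩ : Bornology.IsBounded Ω) (hε : 0 < ε) (hJ : IsInfluenceFunction J) {re rc : ℝ}
    (hg : IsCohesivePotential g re rc) (b u : dispSpace Ω) :
    ∃ F : dispSpace Ω, ((F : LInfty Ω) : Vec d → Vec d) =ᵐ[volume.restrict Ω]
      fun x => forceOp Ω ε J g (u : LInfty Ω) x - (b : LInfty Ω) x := by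
  have := isFiniteMeasure_restrict_of_isBounded hΩ
  have hu := measurable_coe (u : LInfty Ω)
  have hmeas := measurable_forceOp Ω ε hJ g hu
  obtain ⟨C, hC⟩ := exists_norm_forceOp_le hd hΩm hΩ hε hJ hg (u : LInfty Ω)
  have hbd : ∀ᵐ x ∂volume.restrict Ω, ‖forceOp Ω ε J g (u : LInfty Ω) x‖ ≤ C := by
    filter_upwards [ae_restrict_mem hΩm] with x hx using hC x hx
  have hmem : MemLp (forceOp Ω ε J g (u : LInfty Ω)) ∞ (volume.restrict Ω) :=
    memLp_top_of_bound hmeas.aestronglyMeasurable C hbd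
  -- The first variation in the direction of a rigid motion vanishes because its strain does.
  have hL : hmem.toLp _ ∈ dispSpace Ω := by
    intro ρ hρ
    obtain ⟨R, hR⟩ := (hΩ.isCompact_closure.image
      (continuous_of_mem_rigidMotions hρ)).isBounded.exists_norm_le
    have hρb : ∀ᵐ x ∂volume.restrict Ω, ‖ρ x‖ ≤ R := by
      filter_upwards [ae_restrict_mem hΩm] with x hx
      exact hR _ (mem_image_of_mem ρ (subset_closure hx))
    have hρm := (continuous_of_mem_rigidMotions hρ).measurable
    have heq : (fun x => inner ℝ (hmem.toLp _ x) (ρ x)) =ᵐ[volume.restrict Ω]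
        fun x => inner ℝ (forceOp Ω ε J g (u : LInfty Ω) x) (ρ x) := by
      filter_upwards [hmem.coeFn_toLp] with x hx
      rw [hx]
    constructor
    · refine (integrable_congr heq).2 (Integrable.of_bound
        (hmeas.aestronglyMeasurable.inner hρm.aestronglyMeasurable) (C * R) ?_)
      filter_upwards [hbd, hρb] with x h1 h2
      exact (norm_inner_le_norm _ _).trans
        (mul_le_mul h1 h2 (norm_nonneg _) ((norm_nonneg _).trans h1))
    · rw [integral_congr_ae heq,
        ← (integral_first_variation hd hΩm hΩ hε hJ hg hu hρm hρb).2]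
      simp [scaledStrain_of_mem_rigidMotions hρ]
  refine ⟨⟨hmem.toLp _, hL⟩ - b, ?_⟩
  rw [Submodule.coe_sub]
  filter_upwards [Lp.coeFn_sub (hmem.toLp _) (b : LInfty Ω), hmem.coeFn_toLp] with x h1 h2
  rw [h1, Pi.sub_apply, h2]

/-- The load term is linear, so it contributes nothing to the remainder. -/
theorem energy_sub_sub_pairing (hΩ : Bornology.IsBounded Ω) {b u F : dispSpace Ω}
    (hF : ((F : LInfty Ω) : Vec d → Vec d) =ᵐ[volume.restrict Ω]
      fun x => forceOp Ω ε J g (u : LInfty Ω) x - (b : LInfty Ω) x) (v : dispSpace Ω) :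
    energy ε J g b v - energy ε J g b u - pairing hΩ F (v - u) =
      potentialEnergy Ω ε J g (v : LInfty Ω) - potentialEnergy Ω ε J g (u : LInfty Ω) -
        ∫ x in Ω, inner ℝ (forceOp Ω ε J g (u : LInfty Ω) x)
          ((v : LInfty Ω) x - (u : LInfty Ω) x) := by
  have h1 : ∫ x in Ω, inner ℝ (forceOp Ω ε J g (u : LInfty Ω) x)
      ((v : LInfty Ω) x - (u : LInfty Ω) x) =
      pairing hΩ F (v - u) + ((∫ x in Ω, inner ℝ ((v : LInfty Ω) x) ((b : LInfty Ω) x)) -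
        ∫ x in Ω, inner ℝ ((u : LInfty Ω) x) ((b : LInfty Ω) x)) := by
    have hvb := integrable_inner_lInfty hΩ (v : LInfty Ω) b
    have hub := integrable_inner_lInfty hΩ (u : LInfty Ω) b
    have hsub : Integrable (fun x => inner ℝ ((v : LInfty Ω) x) ((b : LInfty Ω) x) -
        inner ℝ ((u : LInfty Ω) x) ((b : LInfty Ω) x)) (volume.restrict Ω) := hvb.sub hub
    rw [pairing_apply, ← integral_sub hvb hub,
      ← integral_add (integrable_inner_lInfty hΩ _ _) hsub]
    refine integral_congr_ae ?_
    filter_upwards [hF, Lp.coeFn_sub (v : LInfty Ω) (u : LInfty Ω)] with x h1 h2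
    rw [Submodule.coe_sub, h2, h1, Pi.sub_apply, ← inner_sub_left,
      real_inner_comm ((b : LInfty Ω) x), ← inner_add_left, sub_add_cancel]
  rw [h1]
  simp only [energy, totalEnergy]
  ring

theorem hasFDerivAt_energy (hΩm : MeasurableSet Ω) (hd : 2 ≤ d)
    (hΩ : Bornology.IsBounded Ω) (hε : 0 < ε) (hJ : IsInfluenceFunction J) {re rc : ℝ}
    (hg : IsCohesivePotential g re rc) {b u F : dispSpace Ω}
    (hF : ((F : LInfty Ω) : Vec d → Vec d) =ᵐ[volume.restrict Ω]
      fun x => forceOp Ω ε J g (u : LInfty Ω) x - (b : LInfty Ω) x) :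
    HasFDerivAt (fun v : dispSpace Ω => energy ε J g b v) (pairing hΩ F) u := by
  obtain ⟨K, hK⟩ := exists_abs_potentialEnergy_sub_sub_le hd hΩm hΩ hε hJ hg
  refine HasFDerivAt.of_isLittleO ?_
  refine Asymptotics.IsBigO.trans_isLittleO (g := fun v => ‖v - u‖ ^ 2) ?_
    (Asymptotics.isLittleO_pow_sub_sub u one_lt_two)
  refine Asymptotics.IsBigO.of_bound K (Eventually.of_forall fun v => ?_)
  rw [energy_sub_sub_pairing hΩ hF v, Real.norm_eq_abs,
    Real.norm_of_nonneg (by positivity)]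
  exact hK (measurable_coe _) (measurable_coe _) (ae_norm_sub_le_norm_sub (u : LInfty Ω) v)

/-- The Euler–Lagrange equation. -/
theorem isCriticalPoint_iff (hΩm : MeasurableSet Ω) (hd : 2 ≤ d)
    (hΩ : Bornology.IsBounded Ω) (hε : 0 < ε) (hJ : IsInfluenceFunction J) {re rc : ℝ}
    (hg : IsCohesivePotential g re rc) (b u : dispSpace Ω) :
    IsCriticalPoint ε J g b u ↔
      forceOp Ω ε J g (u : LInfty Ω) =ᵐ[volume.restrict Ω] (b : LInfty Ω) := by
  obtain ⟨F, hF⟩ := exists_residual hd hΩm hΩ hε hJ hg b u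
  have hD := hasFDerivAt_energy hΩm hd hΩ hε hJ hg hF
  constructor
  · intro h
    -- The residual is itself an admissible test field, and its pairing with itself is its squared
    -- L² norm.
    have h0 : pairing hΩ F F = 0 := by
      rw [hD.unique h, _root_.zero_apply]
    filter_upwards [hF, ae_eq_zero_of_integral_inner_self hΩ h0] with x h1 h2
    rw [h2, Pi.zero_apply] at h1
    exact sub_eq_zero.1 h1.symm
  · intro h
    have h0 : pairing hΩ F = 0 := by
      ext w
      rw [pairing_apply, _root_.zero_apply]
      refine integral_eq_zero_of_ae ?_
      filter_upwards [hF, h] with x h1 h2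
      rw [h1, h2, sub_self, inner_zero_left, Pi.zero_apply]
    rw [h0] at hD
    exact hD

theorem StrictlyInStrengthDomain.inStrengthDomain {re rc : ℝ} {u : Vec d → Vec d}
    (h : StrictlyInStrengthDomain Ω ε re rc u) : InStrengthDomain Ω ε re rc u := by
  obtain ⟨a, b, ha, -, hb, h⟩ := h
  filter_upwards [h] with x hx
  filter_upwards [hx] with y hy
  exact ⟨ha.trans_le hy.1, hy.2.trans_lt hb⟩

/-- Passing from iterated to product a.e. statements needs a measurable set, hence a measurable
representative. -/
theorem InStrengthDomain.ae_prod {re rc : ℝ} {u : Vec d → Vec d} (hu : Measurable u)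
    (h : InStrengthDomain Ω ε re rc u) :
    ∀ᵐ p ∂(volume.restrict Ω).prod (volume.restrict Ω),
      ‖p.2 - p.1‖ < ε → scaledStrain p.2 p.1 u ∈ Ioo re rc := by
  have hm : MeasurableSet {p : Vec d × Vec d |
      ‖p.2 - p.1‖ < ε → scaledStrain p.2 p.1 u ∈ Ioo re rc} :=
    MeasurableSet.imp (measurableSet_lt (by fun_prop) measurable_const)
      (measurable_scaledStrain hu measurableSet_Ioo)
  rw [Measure.ae_prod_iff_ae_ae hm]
  filter_upwards [h] with x hx
  rw [← Measure.restrict_restrict measurableSet_ball, ae_restrict_iff' measurableSet_ball] at hx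
  filter_upwards [hx] with y hy hlt
  exact hy (mem_ball_iff_norm.2 hlt)

/-- A field in `𝒱` with vanishing strain on almost all short bonds vanishes. -/
theorem dispSpace_eq_of_scaledStrain_eq (hΩ_open : IsOpen Ω) (hΩ_conn : IsConnected Ω)
    (hΩ : Bornology.IsBounded Ω) {η : ℝ} (hη : 0 < η) {u v : dispSpace Ω}
    (h : ∀ᵐ p ∂(volume.restrict Ω).prod (volume.restrict Ω), p.2 - p.1 ≠ 0 → ‖p.2 - p.1‖ < η →
      scaledStrain p.2 p.1 (u : LInfty Ω) = scaledStrain p.2 p.1 (v : LInfty Ω)) : v = u := by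
  have h1 : ∀ᵐ x ∂volume.restrict Ω, ∀ᵐ y ∂volume.restrict Ω, ‖y - x‖ < η →
      inner ℝ (((v : LInfty Ω) y - (u : LInfty Ω) y) - ((v : LInfty Ω) x - (u : LInfty Ω) x))
        (y - x) = 0 := by
    filter_upwards [Measure.ae_ae_of_ae_prod h] with x hx
    filter_upwards [hx] with y hy hlt
    rcases eq_or_ne (y - x) 0 with h0 | h0
    · rw [h0, inner_zero_right]
    · have hs : scaledStrain y x (fun z => (v : LInfty Ω) z - (u : LInfty Ω) z) = 0 := by
        rw [scaledStrain_sub, hy h0 hlt, sub_self]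
      have hpos : 0 < ‖y - x‖ := norm_pos_iff.2 h0
      simp only [scaledStrain, strain, unitVec, real_inner_smul_left,
        real_inner_smul_right] at hs
      simpa [hpos.ne', h0, (Real.sqrt_pos.2 hpos).ne'] using hs
  obtain ⟨ρ, hρ, hw⟩ := exists_rigidMotion_of_isConnected
    (w := fun x => (v : LInfty Ω) x - (u : LInfty Ω) x) hΩ_open hΩ_conn hη h1
  have h2 : (((v - u : dispSpace Ω) : LInfty Ω) : Vec d → Vec d) =ᵐ[volume.restrict Ω] ρ := by
    rw [Submodule.coe_sub]
    exact (Lp.coeFn_sub _ _).trans hw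
  -- v - u is a rigid motion and orthogonal to all of them, hence to itself.
  have h3 := ((v - u).2 ρ hρ).2
  have h4 : ∫ x in Ω, inner ℝ (((v - u : dispSpace Ω) : LInfty Ω) x)
      (((v - u : dispSpace Ω) : LInfty Ω) x) = 0 := by
    rw [← h3]
    refine integral_congr_ae ?_
    filter_upwards [h2] with x hx
    rw [hx]
  have h5 := ae_eq_zero_of_integral_inner_self hΩ h4
  have h6 : ((v - u : dispSpace Ω) : LInfty Ω) = 0 := (Lp.eq_zero_iff_ae_eq_zero).2 h5
  exact sub_eq_zero.1 (Subtype.ext h6)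

/-- A critical point in the strength domain is the unique minimizer of the energy there. -/
theorem IsCriticalPoint.energy_le (hΩ_open : IsOpen Ω) (hΩ_conn : IsConnected Ω) (hd : 2 ≤ d)
    (hΩ : Bornology.IsBounded Ω) (hε : 0 < ε) (hJ : IsInfluenceFunction J) {re rc : ℝ}
    (hg : IsCohesivePotential g re rc) {b u : dispSpace Ω} (hcrit : IsCriticalPoint ε J g b u)
    (hu : InStrengthDomain Ω ε re rc (u : LInfty Ω)) {v : dispSpace Ω}
    (hv : InStrengthDomain Ω ε re rc (v : LInfty Ω)) :
    energy ε J g b u ≤ energy ε J g b v ∧ (energy ε J g b v = energy ε J g b u → v = u) := by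
  have hΩm := hΩ_open.measurableSet
  obtain ⟨F, hF⟩ := exists_residual hd hΩm hΩ hε hJ hg b u
  have h0 : pairing hΩ F = 0 := (hasFDerivAt_energy hΩm hd hΩ hε hJ hg hF).unique hcrit
  have h1 := energy_sub_sub_pairing hΩ hF v
  obtain ⟨hint, h2⟩ := potentialEnergy_sub_sub hd hΩm hΩ hε hJ hg (measurable_coe (u : LInfty Ω))
    (measurable_coe (v : LInfty Ω)) (ae_norm_sub_le_norm_sub (u : LInfty Ω) v)
  rw [h0, _root_.zero_apply, sub_zero, h2] at h1
  have hu' := hu.ae_prod (measurable_coe _)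
  have hv' := hv.ae_prod (measurable_coe _)
  have hnn : 0 ≤ᵐ[(volume.restrict Ω).prod (volume.restrict Ω)]
      fun p : Vec d × Vec d => bondWeight ε J (p.2 - p.1) *
        (g (scaledStrain p.2 p.1 (v : LInfty Ω)) - g (scaledStrain p.2 p.1 (u : LInfty Ω)) -
          deriv g (scaledStrain p.2 p.1 (u : LInfty Ω)) *
            (scaledStrain p.2 p.1 (v : LInfty Ω) - scaledStrain p.2 p.1 (u : LInfty Ω))) := by
    filter_upwards [hu', hv'] with p hpu hpv
    by_cases hlt : ‖p.2 - p.1‖ < ε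
    · exact mul_nonneg (bondWeight_nonneg hε hJ _) (hg.tangent_le (hpu hlt) (hpv hlt))
    · rw [bondWeight, if_neg hlt, zero_mul, Pi.zero_apply]
  refine ⟨sub_nonneg.1 (h1 ▸ integral_nonneg_of_ae hnn), fun heq => ?_⟩
  rw [heq, sub_self] at h1
  -- Equal energies force the nonnegative remainder to vanish a.e.; strict convexity then equates
  -- the strains wherever the weight is positive.
  have hz := (integral_eq_zero_iff_of_nonneg_ae hnn hint).1 h1.symm
  obtain ⟨η, hη, hpos⟩ := exists_bondWeight_pos (d := d) hε hJ
  refine dispSpace_eq_of_scaledStrain_eq hΩ_open hΩ_conn hΩ hη ?_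
  filter_upwards [hu', hv', hz] with p hpu hpv hpz hne hlt
  obtain ⟨hlt', hk⟩ := hpos _ hne hlt
  by_contra hne'
  exact (mul_pos hk (hg.tangent_lt (hpu hlt') (hpv hlt') hne')).ne' hpz

end CriticalPoints

end Peridynamics

end

theorem theorem3p6 {d : ℕ} (hd : d = 2 ∨ d = 3)
    {Ω : Set (Peridynamics.Vec d)} (hΩ_open : IsOpen Ω) (hΩ_conn : IsConnected Ω)
    (hΩ_bdd : Bornology.IsBounded Ω)
    {ε : ℝ} (hε : 0 < ε)
    {J : ℝ → ℝ} (hJ : Peridynamics.IsInfluenceFunction J)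
    {g : ℝ → ℝ} {re rc : ℝ} (hg : Peridynamics.IsCohesivePotential g re rc)
    (b₀ u₀ : Peridynamics.dispSpace Ω)
    (hu₀ : Peridynamics.StrictlyInStrengthDomain Ω ε re rc
      (u₀ : Peridynamics.LInfty Ω))
    (hcrit : Peridynamics.IsCriticalPoint ε J g b₀ u₀) :
    (∀ u : Peridynamics.dispSpace Ω, Peridynamics.IsCriticalPoint ε J g b₀ u ↔
      Peridynamics.forceOp Ω ε J g (u : Peridynamics.LInfty Ω)
        =ᵐ[MeasureTheory.volume.restrict Ω] (b₀ : Peridynamics.LInfty Ω)) ∧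
    ∃ R : ℝ, 0 < R ∧
      ∀ u : Peridynamics.dispSpace Ω, ‖u - u₀‖ ≤ R →
        Peridynamics.InStrengthDomain Ω ε re rc (u : Peridynamics.LInfty Ω) →
          Peridynamics.energy ε J g b₀ u₀ ≤ Peridynamics.energy ε J g b₀ u ∧
          (Peridynamics.energy ε J g b₀ u = Peridynamics.energy ε J g b₀ u₀ → u = u₀) ∧
          (Peridynamics.IsCriticalPoint ε J g b₀ u → u = u₀) := by
  have hd2 : 2 ≤ d := by omega
  refine ⟨fun u => Peridynamics.isCriticalPoint_iff hΩ_open.measurableSet hd2 hΩ_bdd hε hJ hg b₀ u,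
    -- The comparison is global on the strength domain, so the radius is arbitrary.
    1, one_pos, fun u _ hu => ?_⟩
  have hu₀' := hu₀.inStrengthDomain
  obtain ⟨h1, h2⟩ := hcrit.energy_le hΩ_open hΩ_conn hd2 hΩ_bdd hε hJ hg hu₀' hu
  -- Two critical points in the strength domain each minimize there, so their energies agree and the
  -- equality case applies.
  exact ⟨h1, h2, fun hc => h2 (le_antisymm
    (hc.energy_le hΩ_open hΩ_conn hd2 hΩ_bdd hε hJ hg hu hu₀').1 h1)⟩
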